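/- A plane tree is a finite set $t$ of finite words over $\{1,2,3,\dots\}$ that contains the empty word $\varnothing$ (the root), contains with each nonempty word $u_1\cdots u_m$ its parent $u_1\cdots u_{m-1}$, and in which, for each $u\in t$, there is an integer $k_u(t)\ge 0$ such that the children of $u$ in $t$ are exactly $u1,u2,\dots,uk_u(t)$. A plane tree is viewed as a graph by joining each nonempty word to its parent. For $u,v\in t$ let $(t,u)_{v\downarrow}$ be the set of $w\in t$ such that $v$ lies on the path from $u$ to $w$ in this graph, and put \[ \varphi_t(u)=\prod_{v\in t\setminus\{u\}}\big|(t,u)_{v\downarrow}\big|,\qquad \Phi(t)=\frac{\varphi_t(\varnothing)}{\min_{u\in t}\varphi_t(u)} . \] For $n\ge 1$, the uniform attachment law $\mathrm{UA}(n)$ is the law of the random plane tree $T_n$ in the sequence defined by $T_1=\{\varnothing\}$ and $T_{n+1}=T_n\cup\{V_n(k_{V_n}(T_n)+1)\}$, where, conditionally given $(T_1,\dots,T_n)$, the node $V_n$ is uniformly random in $T_n$ (that is, a new last child is attached to a uniformly random node). **Proposition.** There exist universal constants $C,c>0$ such that, if $T_n\sim\mathrm{UA}(n)$ for each $n\ge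 1$, then for all real $x\ge 1$ \[ \limsup_{n\to\infty}\mathbb{P}\big(\Phi(T_n)\ge x\big)\le C\,x^{-c}. \] -/

import Mathlib

open Filter MeasureTheory ProbabilityTheory
open scoped ENNReal

/-! ### Centrality and competitive ratio in a finite graph-theoretic tree -/

/-- `G.nodesBelow u v` is the node set of the subtree `(T, u)_{v↓}` of descendants of `v` (with `v`
itself included) when the tree `T = G` is rooted at `u`: the nodes `w` such that `v` lies on the
path from `u` to `w`. -/
def SimpleGraph.nodesBelow {V : Type*} (G : SimpleGraph V) (u v : V) : Set V :=
  {w | ∃ p : G.Walk u w, p.IsPath ∧ v ∈ p.support}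

/-- The centrality measure `φ_T(u) = ∏_{v ≠ u} |(T, u)_{v↓}|`. -/
noncomputable def SimpleGraph.centrality {V : Type*} [Fintype V] [DecidableEq V]
    (G : SimpleGraph V) (u : V) : ℝ :=
  ∏ v ∈ Finset.univ.erase u, ((G.nodesBelow u v).ncard : ℝ)

/-- The competitive ratio `φ_T(r) / min_u φ_T(u)` of a finite tree with root `r`. -/
noncomputable def SimpleGraph.competitiveRatio {V : Type*} [Fintype V] [DecidableEq V]
    (G : SimpleGraph V) (r : V) : ℝ :=
  G.centrality r / Finset.univ.inf' ⟨r, Finset.mem_univ r⟩ G.centrality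

/-! ### Plane trees -/

/-- A plane tree: a finite set of words over the positive integers which contains the empty word,
contains the parent of each of its nonempty words, and in which the children of any node `u` are
`u * 1, …, u * k` for some `k ≥ 0`. -/
@[ext]
structure PlaneTree where
  nodes : Finset (List ℕ+)
  nil_mem : [] ∈ nodes
  parent_mem : ∀ (u : List ℕ+) (j : ℕ+), u ++ [j] ∈ nodes → u ∈ nodes
  exists_children : ∀ u ∈ nodes, ∃ k : ℕ, ∀ j : ℕ+, u ++ [j] ∈ nodes ↔ (j : ℕ) ≤ k

namespace PlaneTree

instance : MeasurableSpace PlaneTree := ⊤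

/-- The root of a plane tree is the empty word. -/
def root (t : PlaneTree) : t.nodes := ⟨[], t.nil_mem⟩

instance (t : PlaneTree) : Nonempty t.nodes := ⟨t.root⟩

/-- The number of children of `u` in `t`. -/
noncomputable def numChildren (t : PlaneTree) (u : List ℕ+) : ℕ :=
  {j : ℕ+ | u ++ [j] ∈ t.nodes}.ncard

theorem mem_child_iff (t : PlaneTree) {u : List ℕ+} (hu : u ∈ t.nodes) (j : ℕ+) :
    u ++ [j] ∈ t.nodes ↔ (j : ℕ) ≤ t.numChildren u := by
  obtain ⟨k, hk⟩ := t.exists_children u hu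
  have h : t.numChildren u = k := by
    have h1 : ((fun j : ℕ+ => (j : ℕ)) '' {j : ℕ+ | u ++ [j] ∈ t.nodes})
        = (Finset.Icc 1 k : Finset ℕ) := by
      ext m
      simp only [Set.mem_image, Set.mem_ofPred_eq, hk, Finset.coe_Icc, Set.mem_Icc]
      constructor
      · rintro ⟨j, hj, rfl⟩
        exact ⟨j.pos, hj⟩
      · rintro ⟨h0, h1⟩
        exact ⟨⟨m, h0⟩, h1, rfl⟩
    rw [numChildren, ← Set.ncard_image_of_injective _ PNat.coe_injective, h1,
      Set.ncard_coe_finset, Nat.card_Icc]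
    omega
  rw [h, hk]

/-- The plane tree consisting of the root only. -/
def single : PlaneTree where
  nodes := {[]}
  nil_mem := by simp
  parent_mem := by simp
  exists_children := fun u _ => ⟨0, fun j => by simp⟩

/-- The plane tree obtained from `t` by attaching to the node `v` a new last child, the word
`v * (k + 1)` where `k` is the number of children of `v` in `t`. -/
noncomputable def addChild (t : PlaneTree) (v : t.nodes) : PlaneTree where
  nodes := insert (v.1 ++ [(t.numChildren v.1).succPNat]) t.nodes
  nil_mem := by simp [t.nil_mem]
  parent_mem := by
    intro u j h
    rcases Finset.mem_insert.1 h with h | h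
    · rw [(List.append_inj' h rfl).1]
      exact Finset.mem_insert_of_mem v.2
    · exact Finset.mem_insert_of_mem (t.parent_mem u j h)
  exists_children := by
    intro u hu
    rcases Finset.mem_insert.1 hu with rfl | hu
    · refine ⟨0, fun j => ?_⟩
      have hnot : v.1 ++ [(t.numChildren v.1).succPNat] ∉ t.nodes := by
        rw [t.mem_child_iff v.2]
        simp
      constructor
      · intro h
        rcases Finset.mem_insert.1 h with h | h
        · simp at h
        · exact absurd (t.parent_mem _ _ h) hnot
      · intro h
        have := j.pos
        omega
    · by_cases huv : u = v.1
      · subst huv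
        refine ⟨t.numChildren v.1 + 1, fun j => ?_⟩
        rw [Finset.mem_insert, t.mem_child_iff v.2]
        have : v.1 ++ [j] = v.1 ++ [(t.numChildren v.1).succPNat]
            ↔ (j : ℕ) = t.numChildren v.1 + 1 := by
          simp [← PNat.coe_inj]
        rw [this]
        omega
      · refine ⟨t.numChildren u, fun j => ?_⟩
        rw [Finset.mem_insert, t.mem_child_iff hu]
        have : u ++ [j] ≠ v.1 ++ [(t.numChildren v.1).succPNat] := fun h =>
          huv (List.append_inj' h rfl).1
        simp [this]

/-- The graph of a plane tree: the edges join each node to its children. -/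
def graph (t : PlaneTree) : SimpleGraph t.nodes :=
  SimpleGraph.fromRel fun u v => ∃ j : ℕ+, v.1 = u.1 ++ [j]

/-- The competitive ratio `Φ(t)` of a plane tree `t`, rooted at the empty word. -/
noncomputable def competitiveRatio (t : PlaneTree) : ℝ :=
  t.graph.competitiveRatio t.root

/-- One step of uniform attachment: attach a new last child to a uniformly random node. -/
noncomputable def attachStep (t : PlaneTree) : PMF PlaneTree :=
  (PMF.uniformOfFintype t.nodes).map t.addChild

/-- The law `UA(n)` of the uniform attachment tree with `n ≥ 1` nodes, as a random plane tree
(the value at `n = 0` is irrelevant). -/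
noncomputable def uaLaw : ℕ → PMF PlaneTree
  | 0 => PMF.pure single
  | 1 => PMF.pure single
  | n + 2 => (uaLaw (n + 1)).bind attachStep

end PlaneTree

/-! Moving the root of a tree with `n` nodes across an edge into a component of size `s` multiplies
the centrality by `(n - s) / s`. Hence `√(φ(∅) / φ(u))` is the product of `√(s / (n - s))` over the
subtree sizes `s` along the path from `∅` to `u` (`sqrt_centrality_div`), and `√Φ`, the maximum over
`u`, is at most the sum over all `u`.

Under uniform attachment this sum has an explicit mean. The branches at the root satisfy `E ∑
f(branch) = ∑_{k<n} E f(T_k) / k` (`uaMean_branchSum`), so for any fixed weight `w` the total of the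
path products has mean `∏_{k<n} (1 + w k / k)` (`uaMean_totalWeight`). For `w k = √(k / (n - k))`
the exponents `w k / k` sum to at most 4, so `E √Φ ≤ e⁴` for every `n`, and Markov's inequality
gives the tail bound. Without the square root they would be `1 / (n - k)`, with unbounded sum. -/

namespace SimpleGraph

/-! ### Rerooting a tree across an edge -/

variable {V : Type*} {G : SimpleGraph V}

theorem IsAcyclic.eq_of_isPath (hG : G.IsAcyclic) {u v : V} {p q : G.Walk u v}
    (hp : p.IsPath) (hq : q.IsPath) : p = q :=
  congrArg Subtype.val ((hG.subsingleton_path u v).elim ⟨p, hp⟩ ⟨q, hq⟩)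

theorem IsAcyclic.mem_nodesBelow_iff (hG : G.IsAcyclic) {u v w : V} {p : G.Walk u w}
    (hp : p.IsPath) : w ∈ G.nodesBelow u v ↔ v ∈ p.support := by
  refine ⟨fun ⟨q, hq, hv⟩ => ?_, fun h => ⟨p, hp, h⟩⟩
  have h := hG.eq_of_isPath hp hq
  rwa [h]

/-- In a tree, moving the starting point of a path to a neighbour `b` of `a` either prepends an
edge to it or removes one from it. -/
theorem IsAcyclic.path_eq_cons_or (hG : G.IsAcyclic) {a b w : V} (hab : G.Adj a b)
    {p : G.Walk a w} (hp : p.IsPath) {q : G.Walk b w} (hq : q.IsPath) :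
    (p = Walk.cons hab q ∧ a ∉ q.support) ∨ (q = Walk.cons hab.symm p ∧ b ∉ p.support) := by
  classical
  by_cases ha : a ∈ q.support
  · right
    have hb : b ∉ p.support := by
      intro hb
      -- If also `b ∈ p.support`, each path is a tail of the other, so they have equal length and `a
      -- = b`.
      have h1 := hG.eq_of_isPath hp (hq.dropUntil ha)
      have h2 := hG.eq_of_isPath hq (hp.dropUntil hb)
      have h3 := congrArg Walk.length (q.take_spec ha)
      have h4 := congrArg Walk.length (p.take_spec hb)
      rw [Walk.length_append, ← h1] at h3
      rw [Walk.length_append, ← h2] at h4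
      have h5 : (p.takeUntil b hb).length = 0 := by omega
      exact hab.ne (Walk.eq_of_length_eq_zero h5)
    exact ⟨hG.eq_of_isPath hq (hp.cons hb), hb⟩
  · exact Or.inl ⟨hG.eq_of_isPath hp (hq.cons ha), ha⟩

theorem IsTree.nodesBelow_eq_of_adj (hG : G.IsTree) {a b v : V} (hab : G.Adj a b)
    (hva : v ≠ a) (hvb : v ≠ b) : G.nodesBelow a v = G.nodesBelow b v := by
  ext w
  obtain ⟨p, hp⟩ := hG.connected.exists_isPath a w
  obtain ⟨q, hq⟩ := hG.connected.exists_isPath b w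
  rw [hG.isAcyclic.mem_nodesBelow_iff hp, hG.isAcyclic.mem_nodesBelow_iff hq]
  rcases hG.isAcyclic.path_eq_cons_or hab hp hq with ⟨h, -⟩ | ⟨h, -⟩ <;> rw [h] <;> simp [*]

theorem IsTree.nodesBelow_compl_of_adj (hG : G.IsTree) {a b : V} (hab : G.Adj a b) :
    (G.nodesBelow a b)ᶜ = G.nodesBelow b a := by
  ext w
  obtain ⟨p, hp⟩ := hG.connected.exists_isPath a w
  obtain ⟨q, hq⟩ := hG.connected.exists_isPath b w
  rw [Set.mem_compl_iff, hG.isAcyclic.mem_nodesBelow_iff hp, hG.isAcyclic.mem_nodesBelow_iff hq]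
  rcases hG.isAcyclic.path_eq_cons_or hab hp hq with ⟨h, h'⟩ | ⟨h, h'⟩ <;> simp [h, h']

/-- Rerooting from `a` to `b` changes only the subtrees of `a` and `b` themselves, so all other
factors cancel. -/
theorem IsTree.centrality_mul_of_adj [Fintype V] [DecidableEq V] (hG : G.IsTree) {a b : V}
    (hab : G.Adj a b) :
    G.centrality a * ((G.nodesBelow b a).ncard : ℝ)
      = G.centrality b * ((G.nodesBelow a b).ncard : ℝ) := by
  have ha : b ∈ Finset.univ.erase a := by simp [hab.ne']
  have hb : a ∈ Finset.univ.erase b := by simp [hab.ne]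
  rw [centrality, centrality, ← Finset.mul_prod_erase _ _ ha, ← Finset.mul_prod_erase _ _ hb,
    Finset.erase_right_comm (a := b)]
  have : ∏ v ∈ (Finset.univ.erase a).erase b, ((G.nodesBelow a v).ncard : ℝ)
      = ∏ v ∈ (Finset.univ.erase a).erase b, ((G.nodesBelow b v).ncard : ℝ) := by
    refine Finset.prod_congr rfl fun v hv => ?_
    simp only [Finset.mem_erase, Finset.mem_univ, and_true] at hv
    rw [hG.nodesBelow_eq_of_adj hab hv.2 hv.1]
  rw [this]
  ring

theorem IsTree.centrality_pos [Fintype V] [DecidableEq V] (hG : G.IsTree) (u : V) :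
    0 < G.centrality u := by
  refine Finset.prod_pos fun v _ => ?_
  rw [Nat.cast_pos, Set.ncard_pos (Set.toFinite _)]
  obtain ⟨p, hp⟩ := hG.connected.exists_isPath u v
  exact ⟨v, p, hp, p.end_mem_support⟩

end SimpleGraph

/-! ### Plane trees as graph-theoretic trees -/

namespace PlaneTree

theorem graph_adj_child (t : PlaneTree) {u : List ℕ+} {j : ℕ+} (hu : u ∈ t.nodes)
    (hj : u ++ [j] ∈ t.nodes) : t.graph.Adj ⟨u, hu⟩ ⟨u ++ [j], hj⟩ := by
  rw [graph, SimpleGraph.fromRel_adj]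
  exact ⟨by simp, Or.inl ⟨j, rfl⟩⟩

theorem graph_adj_iff (t : PlaneTree) (a b : t.nodes) :
    t.graph.Adj a b ↔ (∃ j : ℕ+, b.1 = a.1 ++ [j]) ∨ ∃ j : ℕ+, a.1 = b.1 ++ [j] := by
  rw [graph, SimpleGraph.fromRel_adj, and_iff_right_iff_imp]
  rintro (⟨j, h⟩ | ⟨j, h⟩) rfl <;> simp at h

theorem graph_connected (t : PlaneTree) : t.graph.Connected := by
  have key : ∀ (u : List ℕ+) (hu : u ∈ t.nodes), t.graph.Reachable t.root ⟨u, hu⟩ := by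
    intro u
    induction u using List.reverseRecOn with
    | nil => exact fun _ => SimpleGraph.Reachable.refl _
    | append_singleton u j ih =>
      intro hu
      exact (ih (t.parent_mem u j hu)).trans (t.graph_adj_child (t.parent_mem u j hu) hu).reachable
  exact ⟨fun a b => (key a.1 a.2).symm.trans (key b.1 b.2)⟩

/-- The edge from `u` to its child `uj` is the only one between the words that extend `uj` and
those that do not. -/
theorem eq_of_adj_of_prefix (t : PlaneTree) {u : List ℕ+} {j : ℕ+} {a b : t.nodes}
    (hab : t.graph.Adj a b) (ha : ¬ u ++ [j] <+: a.1) (hb : u ++ [j] <+: b.1) :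
    a.1 = u ∧ b.1 = u ++ [j] := by
  rcases (t.graph_adj_iff a b).1 hab with ⟨i, h⟩ | ⟨i, h⟩
  · rw [h, List.prefix_concat_iff] at hb
    rcases hb with hb | hb
    · exact ⟨(List.append_inj' hb rfl).1.symm, h.trans hb.symm⟩
    · exact absurd hb ha
  · exact absurd (h ▸ hb.trans (List.prefix_append _ _)) ha

/-- A walk entering the set of extensions of `uj` must cross its boundary, which is this single
edge. This yields both acyclicity and the description of the nodes below a child. -/
theorem mem_support_of_prefix (t : PlaneTree) {u : List ℕ+} {j : ℕ+} (hu : u ∈ t.nodes)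
    (hj : u ++ [j] ∈ t.nodes) {a b : t.nodes} (p : t.graph.Walk a b) (ha : ¬ u ++ [j] <+: a.1)
    (hb : u ++ [j] <+: b.1) :
    s(⟨u, hu⟩, ⟨u ++ [j], hj⟩) ∈ p.edges := by
  obtain ⟨d, hd, h1, h2⟩ := p.exists_boundary_dart {x | ¬ u ++ [j] <+: x.1} ha (by simpa using hb)
  obtain ⟨h3, h4⟩ := t.eq_of_adj_of_prefix d.adj h1 (by simpa using h2)
  refine List.mem_map.2 ⟨d, hd, ?_⟩
  rw [SimpleGraph.dart_edge_eq_mk'_iff]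
  exact Or.inl (Prod.ext (Subtype.ext h3) (Subtype.ext h4))

theorem graph_isAcyclic (t : PlaneTree) : t.graph.IsAcyclic := by
  have key : ∀ a b : t.nodes, (∃ j : ℕ+, b.1 = a.1 ++ [j]) → t.graph.IsBridge s(a, b) := by
    rintro ⟨u, hu⟩ ⟨v, hv⟩ ⟨j, h⟩
    obtain rfl : v = u ++ [j] := h
    rw [SimpleGraph.isBridge_iff_forall_walk_mem_edges]
    exact fun p => t.mem_support_of_prefix hu hv p (fun h => by simpa using h.length_le)
      List.prefix_rfl
  rw [SimpleGraph.isAcyclic_iff_forall_adj_isBridge]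
  intro a b hab
  rcases (t.graph_adj_iff a b).1 hab with h | h
  · exact key a b h
  · rw [Sym2.eq_swap]
    exact key b a h

theorem graph_isTree (t : PlaneTree) : t.graph.IsTree := ⟨t.graph_connected, t.graph_isAcyclic⟩

theorem nodesBelow_child (t : PlaneTree) {u : List ℕ+} {j : ℕ+} (hu : u ∈ t.nodes)
    (hj : u ++ [j] ∈ t.nodes) :
    t.graph.nodesBelow ⟨u, hu⟩ ⟨u ++ [j], hj⟩ = {w | u ++ [j] <+: w.1} := by
  ext w
  by_cases hw : u ++ [j] <+: w.1
  · obtain ⟨p, hp⟩ := t.graph_connected.exists_isPath ⟨u, hu⟩ w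
    have := t.mem_support_of_prefix hu hj p (fun h => by simpa using h.length_le) hw
    exact iff_of_true ⟨p, hp, p.snd_mem_support_of_mem_edges this⟩ hw
  · refine iff_of_false ?_ hw
    rw [← Set.mem_compl_iff, t.graph_isTree.nodesBelow_compl_of_adj (t.graph_adj_child hu hj)]
    obtain ⟨p, hp⟩ := t.graph_connected.exists_isPath ⟨u ++ [j], hj⟩ w
    have := t.mem_support_of_prefix hu hj p.reverse hw List.prefix_rfl
    rw [SimpleGraph.Walk.edges_reverse, List.mem_reverse] at this
    exact ⟨p, hp, p.fst_mem_support_of_mem_edges this⟩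

/-- The number of nodes of `t` that extend the word `u`. -/
noncomputable def sizeBelow (t : PlaneTree) (u : List ℕ+) : ℕ := (t.nodes.filter (u <+: ·)).card

theorem centrality_child (t : PlaneTree) {u : List ℕ+} {j : ℕ+} (hu : u ∈ t.nodes)
    (hj : u ++ [j] ∈ t.nodes) :
    t.graph.centrality ⟨u, hu⟩ * ((t.nodes.card : ℝ) - t.sizeBelow (u ++ [j]))
      = t.graph.centrality ⟨u ++ [j], hj⟩ * t.sizeBelow (u ++ [j]) := by
  have hadj := t.graph_adj_child hu hj
  have h1 : (t.graph.nodesBelow ⟨u, hu⟩ ⟨u ++ [j], hj⟩).ncard = t.sizeBelow (u ++ [j]) := by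
    rw [nodesBelow_child, sizeBelow, ← Set.ncard_coe_finset,
      ← Set.ncard_image_of_injective _ Subtype.val_injective]
    congr 1
    ext w
    simp [and_comm]
  have h2 := Set.ncard_add_ncard_compl (t.graph.nodesBelow ⟨u, hu⟩ ⟨u ++ [j], hj⟩)
  rw [t.graph_isTree.nodesBelow_compl_of_adj hadj, h1, Nat.card_eq_fintype_card,
    Fintype.card_coe] at h2
  rw [← h2, Nat.cast_add, add_sub_cancel_left, t.graph_isTree.centrality_mul_of_adj hadj, h1]

theorem sizeBelow_lt_card (t : PlaneTree) {u : List ℕ+} (hu : u ≠ []) :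
    t.sizeBelow u < t.nodes.card := by
  refine Finset.card_lt_card (Finset.filter_ssubset.2 ⟨[], t.nil_mem, ?_⟩)
  simpa using hu

/-! ### Root branches under attachment -/

/-- The subtree of descendants of the child `j` of the root, as a plane tree (a single node if the
root has no child `j`). -/
noncomputable def branch (t : PlaneTree) (j : ℕ+) : PlaneTree := by
  classical
  exact if h : [j] ∈ t.nodes then
    { nodes := t.nodes.preimage (List.cons j) List.cons_injective.injOn
      nil_mem := by simpa using h
      parent_mem := fun u i hi => by
        rw [Finset.mem_preimage] at hi ⊢
        exact t.parent_mem (j :: u) i hi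
      exists_children := fun u hu => by
        rw [Finset.mem_preimage] at hu
        obtain ⟨k, hk⟩ := t.exists_children _ hu
        exact ⟨k, fun i => by simpa using hk i⟩ }
  else single

theorem mem_branch {t : PlaneTree} {j : ℕ+} (h : [j] ∈ t.nodes) {u : List ℕ+} :
    u ∈ (t.branch j).nodes ↔ j :: u ∈ t.nodes := by
  rw [branch, dif_pos h, Finset.mem_preimage]

theorem mem_of_append_mem (t : PlaneTree) {u v : List ℕ+} (h : u ++ v ∈ t.nodes) :
    u ∈ t.nodes := by
  induction v using List.reverseRecOn with
  | nil => simpa using h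
  | append_singleton v j ih => exact ih (t.parent_mem _ j (by simpa using h))

theorem singleton_mem_of_cons_mem (t : PlaneTree) {j : ℕ+} {u : List ℕ+} (h : j :: u ∈ t.nodes) :
    [j] ∈ t.nodes := t.mem_of_append_mem (u := [j]) (v := u) h

theorem numChildren_branch {t : PlaneTree} {j : ℕ+} (h : [j] ∈ t.nodes) (u : List ℕ+) :
    (t.branch j).numChildren u = t.numChildren (j :: u) := by
  simp only [numChildren, mem_branch h, List.cons_append]

theorem ext_mem {s t : PlaneTree} (h : ∀ u, u ∈ s.nodes ↔ u ∈ t.nodes) : s = t :=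
  PlaneTree.ext (Finset.ext h)

theorem mem_addChild (t : PlaneTree) (v : t.nodes) {u : List ℕ+} :
    u ∈ (t.addChild v).nodes ↔ u = v.1 ++ [(t.numChildren v.1).succPNat] ∨ u ∈ t.nodes :=
  Finset.mem_insert

theorem newChild_notMem (t : PlaneTree) (v : t.nodes) :
    v.1 ++ [(t.numChildren v.1).succPNat] ∉ t.nodes := by
  rw [t.mem_child_iff v.2]
  simp

theorem card_addChild (t : PlaneTree) (v : t.nodes) :
    (t.addChild v).nodes.card = t.nodes.card + 1 :=
  Finset.card_insert_of_notMem (t.newChild_notMem v)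

theorem branch_addChild_cons {t : PlaneTree} {j : ℕ+} (hj : [j] ∈ t.nodes)
    (v : (t.branch j).nodes) :
    (t.addChild ⟨j :: v.1, (mem_branch hj).1 v.2⟩).branch j = (t.branch j).addChild v := by
  refine ext_mem fun u => ?_
  rw [mem_branch (((t.mem_addChild _)).2 (Or.inr hj)), mem_addChild, mem_addChild,
    mem_branch hj (u := u), numChildren_branch hj]
  simp

theorem branch_addChild_of_not_prefix {t : PlaneTree} {j : ℕ+} (hj : [j] ∈ t.nodes)
    (v : t.nodes) (hv : ¬ [j] <+: v.1) : (t.addChild v).branch j = t.branch j := by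
  refine ext_mem fun u => ?_
  rw [mem_branch (((t.mem_addChild _)).2 (Or.inr hj)), mem_addChild, mem_branch hj]
  refine or_iff_right fun h => ?_
  obtain ⟨v, hvt⟩ := v
  cases v with
  | nil =>
    have h0 := t.newChild_notMem ⟨[], hvt⟩
    simp only [List.nil_append, List.cons.injEq] at h h0
    exact h0 (h.1 ▸ hj)
  | cons i v =>
    simp only [List.cons_append, List.cons.injEq] at h
    exact hv (by simp [h.1])

theorem singleton_mem_addChild_iff {t : PlaneTree} {j : ℕ+} (hj : [j] ∉ t.nodes) (v : t.nodes) :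
    [j] ∈ (t.addChild v).nodes ↔ v = t.root ∧ j = (t.numChildren []).succPNat := by
  rw [mem_addChild, or_iff_left hj]
  obtain ⟨v, hv⟩ := v
  cases v with
  | nil => simp [root]
  | cons i v => simp [root]

theorem branch_addChild_root (t : PlaneTree) :
    (t.addChild t.root).branch (t.numChildren []).succPNat = single := by
  have h0 := t.newChild_notMem t.root
  refine ext_mem fun u => ?_
  rw [mem_branch (((t.mem_addChild _)).2 (Or.inl rfl)), mem_addChild, or_iff_left]
  · simp [root, single]
  · exact fun h => h0 (t.singleton_mem_of_cons_mem h)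

/-- The sum of `f` over all ways of attaching a new last child to a node of `t`. -/
noncomputable def attachSum (f : PlaneTree → ℝ≥0∞) (t : PlaneTree) : ℝ≥0∞ :=
  ∑ v : t.nodes, f (t.addChild v)

open Classical in
/-- The sum of `f` over the subtrees descending from the children of the root of `t`. -/
noncomputable def branchSum (f : PlaneTree → ℝ≥0∞) (t : PlaneTree) : ℝ≥0∞ :=
  ∑' j : ℕ+, if [j] ∈ t.nodes then f (t.branch j) else 0

theorem sizeBelow_nil (t : PlaneTree) : t.sizeBelow [] = t.nodes.card := by
  simp [sizeBelow]

theorem sizeBelow_branch {t : PlaneTree} {j : ℕ+} (hj : [j] ∈ t.nodes) (u : List ℕ+) :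
    (t.branch j).sizeBelow u = t.sizeBelow (j :: u) := by
  refine Finset.card_bij (fun v _ => j :: v) (fun v hv => ?_) (fun v _ v' _ h => ?_) fun v hv => ?_
  · simpa [mem_branch hj] using hv
  · simpa using h
  · obtain ⟨hv, v, rfl⟩ := Finset.mem_filter.1 hv
    exact ⟨u ++ v, Finset.mem_filter.2 ⟨(mem_branch hj).2 hv, List.prefix_append _ _⟩, rfl⟩

/-- Attaching outside branch `j` leaves it unchanged; attaching inside it is an attachment step of
the branch. -/
theorem sum_branch_addChild (f : PlaneTree → ℝ≥0∞) (t : PlaneTree) {j : ℕ+}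
    (hj : [j] ∈ t.nodes) :
    ∑ v : t.nodes, f ((t.addChild v).branch j)
      = ((t.nodes.card - (t.branch j).nodes.card : ℕ) : ℝ≥0∞) * f (t.branch j)
        + attachSum f (t.branch j) := by
  classical
  rw [← Finset.sum_filter_not_add_sum_filter _ (fun v : t.nodes => [j] <+: v.1)]
  congr 1
  · rw [Finset.sum_congr rfl (g := fun _ => f (t.branch j)), Finset.sum_const, nsmul_eq_mul]
    · congr 2
      have h1 := Finset.card_filter_add_card_filter_not (s := (Finset.univ : Finset t.nodes))
        (fun v : t.nodes => [j] <+: v.1)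
      have h2 : (Finset.univ.filter (fun v : t.nodes => [j] <+: v.1)).card = t.sizeBelow [j] := by
        rw [sizeBelow, ← Finset.card_map (Function.Embedding.subtype _)]
        congr 1
        ext v
        simp [and_comm]
      rw [h2, ← sizeBelow_branch hj, sizeBelow_nil, Finset.card_univ, Fintype.card_coe] at h1
      omega
    · intro v hv
      rw [branch_addChild_of_not_prefix hj v (Finset.mem_filter.1 hv).2]
  · symm
    refine Finset.sum_bij (fun v _ => ⟨j :: v.1, (mem_branch hj).1 v.2⟩) (fun v _ => ?_)
      (fun u _ v _ h => ?_) (fun v hv => ?_) fun v _ => ?_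
    · exact Finset.mem_filter.2 ⟨Finset.mem_univ _, v.1, rfl⟩
    · exact Subtype.ext (List.cons_injective (congrArg Subtype.val h))
    · obtain ⟨v, hvt⟩ := v
      obtain ⟨u, rfl⟩ := (Finset.mem_filter.1 hv).2
      exact ⟨⟨u, (mem_branch hj).2 hvt⟩, Finset.mem_univ _, rfl⟩
    · rw [branch_addChild_cons hj]

/-- The term `f single` is the branch born when the new node is attached to the root; existing
branches are handled by `sum_branch_addChild`. -/
theorem attachSum_branchSum (f : PlaneTree → ℝ≥0∞) (t : PlaneTree) :
    attachSum (branchSum f) t = f single + branchSum (fun s =>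
      ((t.nodes.card - s.nodes.card : ℕ) : ℝ≥0∞) * f s + attachSum f s) t := by
  classical
  have h : ∀ j : ℕ+,
      ∑ v : t.nodes, (if [j] ∈ (t.addChild v).nodes then f ((t.addChild v).branch j) else 0)
        = (if j = (t.numChildren []).succPNat then f single else 0)
          + if [j] ∈ t.nodes then ((t.nodes.card - (t.branch j).nodes.card : ℕ) : ℝ≥0∞)
            * f (t.branch j) + attachSum f (t.branch j) else 0 := by
    intro j
    by_cases hj : [j] ∈ t.nodes
    · have h0 : j ≠ (t.numChildren []).succPNat := by
        rintro rfl
        exact t.newChild_notMem t.root hj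
      rw [if_neg h0, if_pos hj, zero_add, ← sum_branch_addChild f t hj]
      exact Finset.sum_congr rfl fun v _ => if_pos ((t.mem_addChild v).2 (Or.inr hj))
    · rw [if_neg hj, add_zero]
      simp only [singleton_mem_addChild_iff hj, ite_and]
      rw [Finset.sum_ite_eq' Finset.univ t.root, if_pos (Finset.mem_univ _)]
      split_ifs with h0
      · rw [h0, branch_addChild_root]
      · rfl
  simp only [attachSum, branchSum]
  rw [← Summable.tsum_finsetSum fun _ _ => ENNReal.summable]
  simp only [h]
  rw [ENNReal.tsum_add, tsum_ite_eq]
  rfl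

theorem branchSum_single (f : PlaneTree → ℝ≥0∞) : branchSum f single = 0 := by
  simp [branchSum, single]

/-! ### Expectations under uniform attachment -/

/-- The expectation of `f` under `UA(n)`. -/
noncomputable def uaMean (n : ℕ) (f : PlaneTree → ℝ≥0∞) : ℝ≥0∞ := ∑' t, uaLaw n t * f t

theorem uaLaw_eq_zero {n : ℕ} {t : PlaneTree} (h : t.nodes.card ≠ n + 1) : uaLaw (n + 1) t = 0 := by
  by_contra h0
  rw [← ne_eq, ← PMF.mem_support_iff] at h0
  induction n generalizing t with
  | zero =>
    simp only [uaLaw, PMF.support_pure, Set.mem_singleton_iff] at h0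
    simp [h0, single] at h
  | succ n ih =>
    rw [uaLaw, PMF.mem_support_bind_iff] at h0
    obtain ⟨s, hs, h0⟩ := h0
    rw [attachStep, PMF.mem_support_map_iff] at h0
    obtain ⟨v, -, rfl⟩ := h0
    rw [card_addChild] at h
    exact ih (fun hs' => h (by rw [hs'])) hs

theorem uaMean_congr {n : ℕ} {f g : PlaneTree → ℝ≥0∞}
    (h : ∀ t : PlaneTree, t.nodes.card = n + 1 → f t = g t) :
    uaMean (n + 1) f = uaMean (n + 1) g := by
  refine tsum_congr fun t => ?_
  by_cases ht : t.nodes.card = n + 1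
  · rw [h t ht]
  · simp [uaLaw_eq_zero ht]

theorem uaMean_mono {n : ℕ} {f g : PlaneTree → ℝ≥0∞}
    (h : ∀ t : PlaneTree, t.nodes.card = n + 1 → f t ≤ g t) :
    uaMean (n + 1) f ≤ uaMean (n + 1) g := by
  refine ENNReal.tsum_le_tsum fun t => ?_
  by_cases ht : t.nodes.card = n + 1
  · exact mul_le_mul_right (h t ht) _
  · simp [uaLaw_eq_zero ht]

theorem uaMean_one (f : PlaneTree → ℝ≥0∞) : uaMean 1 f = f single := by
  rw [uaMean, tsum_eq_single single]
  · simp [uaLaw]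
  · intro t ht
    simp [uaLaw, ht]

theorem uaMean_const (n : ℕ) (a : ℝ≥0∞) : uaMean n (fun _ => a) = a := by
  rw [uaMean, ENNReal.tsum_mul_right, PMF.tsum_coe, one_mul]

theorem uaMean_add (n : ℕ) (f g : PlaneTree → ℝ≥0∞) :
    uaMean n (fun t => f t + g t) = uaMean n f + uaMean n g := by
  simp only [uaMean, mul_add, ENNReal.tsum_add]

theorem uaMean_const_mul (n : ℕ) (a : ℝ≥0∞) (f : PlaneTree → ℝ≥0∞) :
    uaMean n (fun t => a * f t) = a * uaMean n f := by
  simp only [uaMean, mul_left_comm _ a, ENNReal.tsum_mul_left]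

theorem uaMean_attachSum (n : ℕ) (f : PlaneTree → ℝ≥0∞) :
    uaMean (n + 1) (attachSum f) = (n + 1) * uaMean (n + 2) f := by
  have h1 : uaMean (n + 2) f = uaMean (n + 1) fun t => ∑' s, attachStep t s * f s := by
    simp only [uaMean, uaLaw, PMF.bind_apply, ← ENNReal.tsum_mul_right, ← ENNReal.tsum_mul_left]
    rw [ENNReal.tsum_comm]
    simp only [mul_assoc]
  rw [h1, ← uaMean_const_mul]
  refine uaMean_congr fun t ht => ?_
  have h2 : ∑' s, attachStep t s * f s = ∑ v : t.nodes, ((n : ℝ≥0∞) + 1)⁻¹ * f (t.addChild v) := by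
    simp only [attachStep, PMF.map, PMF.bind_apply, ← ENNReal.tsum_mul_right]
    rw [ENNReal.tsum_comm, tsum_fintype]
    refine Finset.sum_congr rfl fun v _ => ?_
    rw [tsum_eq_single (t.addChild v)]
    · simp [ht]
    · intro s hs
      simp [hs]
  rw [h2, ← Finset.mul_sum, ← mul_assoc, ENNReal.mul_inv_cancel (by simp) (by finiteness), one_mul]
  rfl

/-- Induction on `n` for all `f` at once: one attachment step replaces `f` by another function of
the branch, to which the induction hypothesis applies. -/
theorem uaMean_branchSum (n : ℕ) (f : PlaneTree → ℝ≥0∞) :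
    uaMean (n + 1) (branchSum f)
      = ∑ k ∈ Finset.range n, uaMean (k + 1) f / ((k : ℝ≥0∞) + 1) := by
  induction n generalizing f with
  | zero => simp [uaMean_one, branchSum_single]
  | succ n ih =>
    have h0 : ((n : ℝ≥0∞) + 1) ≠ 0 := by simp
    have h1 : ((n : ℝ≥0∞) + 1) ≠ ∞ := by finiteness
    refine (ENNReal.mul_right_inj h0 h1).1 ?_
    rw [← uaMean_attachSum, uaMean_congr fun t ht => attachSum_branchSum f t]
    rw [uaMean_congr (g := fun t => f single + branchSum (fun s =>
      ((n + 1 - s.nodes.card : ℕ) : ℝ≥0∞) * f s + attachSum f s) t) fun t ht => by rw [ht]]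
    rw [uaMean_add, uaMean_const, ih, Finset.mul_sum]
    have h2 : ∀ k ∈ Finset.range n,
        uaMean (k + 1) (fun s => ((n + 1 - s.nodes.card : ℕ) : ℝ≥0∞) * f s + attachSum f s)
            / ((k : ℝ≥0∞) + 1)
          = ((n - k : ℕ) : ℝ≥0∞) * (uaMean (k + 1) f / ((k : ℝ≥0∞) + 1)) + uaMean (k + 2) f := by
      intro k hk
      rw [uaMean_add, uaMean_attachSum, ENNReal.add_div, ENNReal.mul_div_right_comm,
        ENNReal.div_self (by simp) (by finiteness), one_mul, ← mul_div_assoc, ← uaMean_const_mul]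
      congr 2
      refine uaMean_congr fun t ht => ?_
      rw [ht, Nat.add_sub_add_right]
    -- `f single` supplies the missing first term of the shifted sum; then the coefficients combine
    -- as `(n - k) / (k + 1) + 1 = (n + 1) / (k + 1)`.
    rw [Finset.sum_congr rfl h2, Finset.sum_add_distrib, add_left_comm, ← uaMean_one f,
      add_comm (uaMean 1 f), ← Finset.sum_range_succ' (fun k => uaMean (k + 1) f),
      Finset.sum_range_succ, Finset.sum_range_succ _ n, ← add_assoc, ← Finset.sum_add_distrib,
      ENNReal.mul_div_cancel h0 h1]
    congr 1
    refine Finset.sum_congr rfl fun k hk => ?_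
    have h3 : (n : ℝ≥0∞) + 1 = ((n - k : ℕ) : ℝ≥0∞) + (k + 1) := by
      have := Finset.mem_range.1 hk
      norm_cast
      omega
    rw [h3, add_mul, ENNReal.mul_div_cancel (by simp) (by finiteness)]

/-! ### Path weights and their mean total -/

/-- The product of the weights `w s` over the sizes `s` of the subtrees descending from the nodes of
the path from the root (excluded) to a node. -/
noncomputable def pathWeight (w : ℕ → ℝ≥0∞) : PlaneTree → List ℕ+ → ℝ≥0∞
  | _, [] => 1
  | t, j :: u => w (t.branch j).nodes.card * pathWeight w (t.branch j) u

open Classical in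
/-- The sum of the path weights of all nodes. -/
noncomputable def totalWeight (w : ℕ → ℝ≥0∞) (t : PlaneTree) : ℝ≥0∞ :=
  ∑' u : List ℕ+, if u ∈ t.nodes then pathWeight w t u else 0

/-- The recursion peels steps off at the root; peeling at the far end matches `centrality_child`. -/
theorem pathWeight_append_singleton (w : ℕ → ℝ≥0∞) (t : PlaneTree) {u : List ℕ+} {j : ℕ+}
    (h : u ++ [j] ∈ t.nodes) :
    pathWeight w t (u ++ [j]) = pathWeight w t u * w (t.sizeBelow (u ++ [j])) := by
  induction u generalizing t with
  | nil => simp [pathWeight, ← sizeBelow_branch h, sizeBelow_nil]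
  | cons i u ih =>
    have hi := t.singleton_mem_of_cons_mem h
    rw [List.cons_append, pathWeight, pathWeight, ih _ ((mem_branch hi).2 h), sizeBelow_branch hi,
      mul_assoc]

theorem pathWeight_le_totalWeight (w : ℕ → ℝ≥0∞) (t : PlaneTree) {u : List ℕ+}
    (h : u ∈ t.nodes) : pathWeight w t u ≤ totalWeight w t := by
  classical
  exact (if_pos h).symm.le.trans (ENNReal.le_tsum u)

theorem totalWeight_eq (w : ℕ → ℝ≥0∞) (t : PlaneTree) :
    totalWeight w t = 1 + branchSum (fun s => w s.nodes.card * totalWeight w s) t := by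
  classical
  have hinj : Function.Injective fun p : ℕ+ × List ℕ+ => p.1 :: p.2 := by
    rintro ⟨i, u⟩ ⟨j, v⟩ h
    simpa using h
  rw [totalWeight, ENNReal.tsum_eq_add_tsum_ite [], if_pos t.nil_mem, pathWeight,
    ← hinj.tsum_eq, ENNReal.tsum_prod']
  · congr 1
    refine tsum_congr fun j => ?_
    by_cases hj : [j] ∈ t.nodes
    · simp [hj, totalWeight, mem_branch hj, pathWeight, ← ENNReal.tsum_mul_left]
    · have h : ∀ u, j :: u ∉ t.nodes := fun u hu => hj (t.singleton_mem_of_cons_mem hu)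
      simp [hj, h]
  · rintro (- | ⟨j, u⟩) h
    · simp at h
    · exact ⟨(j, u), rfl⟩

/-- Splitting at the root expresses each mean through all smaller ones; subtracting consecutive
identities leaves a one-step multiplicative recursion. -/
theorem uaMean_totalWeight (w : ℕ → ℝ≥0∞) (n : ℕ) :
    uaMean (n + 1) (totalWeight w)
      = ∏ k ∈ Finset.range n, (1 + w (k + 1) / ((k : ℝ≥0∞) + 1)) := by
  have h : ∀ n, uaMean (n + 1) (totalWeight w) = 1 + ∑ k ∈ Finset.range n,
      w (k + 1) * uaMean (k + 1) (totalWeight w) / ((k : ℝ≥0∞) + 1) := by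
    intro n
    rw [funext (totalWeight_eq w), uaMean_add, uaMean_const, uaMean_branchSum, ← funext
      (totalWeight_eq w)]
    congr 1
    refine Finset.sum_congr rfl fun k _ => ?_
    rw [← uaMean_const_mul, uaMean_congr fun t ht => by rw [ht]]
  induction n with
  | zero => rw [h, Finset.sum_range_zero, add_zero, Finset.prod_range_zero]
  | succ n ih =>
    rw [h, Finset.sum_range_succ, ← add_assoc, ← h, Finset.prod_range_succ, ← ih, mul_add, mul_one,
      mul_comm (w _), mul_div_assoc]

/-! ### Bounding the mean of `√Φ` -/

/-- The square root of the ratio of the sizes of the two components obtained from a tree with `n`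
nodes by cutting an edge, the component not containing the root having `k` nodes. -/
noncomputable def sqrtRatio (n k : ℕ) : ℝ := √((k : ℝ) / ((n : ℝ) - k))

theorem sqrt_centrality_div (t : PlaneTree) {u : List ℕ+} (hu : u ∈ t.nodes) :
    ENNReal.ofReal (√(t.graph.centrality t.root / t.graph.centrality ⟨u, hu⟩))
      = pathWeight (fun k => ENNReal.ofReal (sqrtRatio t.nodes.card k)) t u := by
  induction u using List.reverseRecOn with
  | nil =>
    have h : t.graph.centrality t.root / t.graph.centrality ⟨[], hu⟩ = 1 :=
      div_self (t.graph_isTree.centrality_pos _).ne'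
    rw [h]
    simp [pathWeight]
  | append_singleton u j ih =>
    have hu' := t.parent_mem u j hu
    rw [pathWeight_append_singleton _ _ hu, ← ih hu', ← ENNReal.ofReal_mul (Real.sqrt_nonneg _),
      sqrtRatio, ← Real.sqrt_mul (div_nonneg (t.graph_isTree.centrality_pos _).le
        (t.graph_isTree.centrality_pos _).le)]
    congr 2
    have h1 := t.centrality_child hu' hu
    have h2 := (t.graph_isTree.centrality_pos ⟨u, hu'⟩).ne'
    have h3 := (t.graph_isTree.centrality_pos ⟨u ++ [j], hu⟩).ne'
    have h4 : (t.nodes.card : ℝ) - t.sizeBelow (u ++ [j]) ≠ 0 := by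
      have : (t.sizeBelow (u ++ [j]) : ℝ) < t.nodes.card :=
        Nat.cast_lt.2 (t.sizeBelow_lt_card (by simp))
      linarith
    rw [div_mul_div_comm, div_eq_div_iff h3 (mul_ne_zero h2 h4), mul_assoc, h1]
    ring

theorem sqrt_competitiveRatio_le (t : PlaneTree) :
    ENNReal.ofReal (√t.competitiveRatio)
      ≤ totalWeight (fun k => ENNReal.ofReal (sqrtRatio t.nodes.card k)) t := by
  obtain ⟨v, -, hv⟩ := Finset.exists_mem_eq_inf' ⟨t.root, Finset.mem_univ t.root⟩
    t.graph.centrality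
  rw [competitiveRatio, SimpleGraph.competitiveRatio, hv, t.sqrt_centrality_div v.2]
  exact pathWeight_le_totalWeight _ _ v.2

theorem sum_one_div_sqrt_le (n : ℕ) :
    ∑ k ∈ Finset.range n, 1 / √((k : ℝ) + 1) ≤ 2 * √n := by
  induction n with
  | zero => simp
  | succ n ih =>
    rw [Finset.sum_range_succ, Nat.cast_add_one]
    have h1 : √(n : ℝ) ^ 2 = n := Real.sq_sqrt (by positivity)
    have h2 : √((n : ℝ) + 1) ^ 2 = n + 1 := Real.sq_sqrt (by positivity)
    have h3 : 0 < √((n : ℝ) + 1) := by positivity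
    have h4 : 1 / √((n : ℝ) + 1) ≤ 2 * √((n : ℝ) + 1) - 2 * √n := by
      rw [div_le_iff₀ h3]
      nlinarith [sq_nonneg (√((n : ℝ) + 1) - √n)]
    linarith

/-- The left side is `1 / (√a √b)`, and `√(a + b) ≤ √a + √b`. -/
theorem sqrt_div_div_le {a b : ℝ} (ha : 0 < a) (hb : 0 < b) :
    √(a / b) / a ≤ 1 / √(a + b) * (1 / √a + 1 / √b) := by
  have h1 : 0 < √a := Real.sqrt_pos.2 ha
  have h2 : 0 < √b := Real.sqrt_pos.2 hb
  have h3 : 0 < √(a + b) := Real.sqrt_pos.2 (by positivity)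
  have h4 : √a * √a = a := Real.mul_self_sqrt ha.le
  have h5 : √(a / b) / a = 1 / (√a * √b) := by
    rw [Real.sqrt_div ha.le]
    nth_rw 2 [← h4]
    field_simp
  have h6 : 1 / √(a + b) * (1 / √a + 1 / √b) = (√a + √b) / √(a + b) * (1 / (√a * √b)) := by
    field_simp
    ring
  rw [h5, h6]
  refine le_mul_of_one_le_left (by positivity) ?_
  rw [one_le_div h3]
  refine Real.sqrt_le_iff.2 ⟨by positivity, ?_⟩
  nlinarith [Real.mul_self_sqrt hb.le, mul_pos h1 h2]

/-- Here `a = k + 1` and `b = n - k` have constant sum `n + 1`. Reflecting `k` turns the second sum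
into the first, and each is at most `2√n`. -/
theorem sum_sqrtRatio_div_le (n : ℕ) :
    ∑ k ∈ Finset.range n, sqrtRatio (n + 1) (k + 1) / ((k : ℝ) + 1) ≤ 4 := by
  have h1 : ∀ k ∈ Finset.range n, sqrtRatio (n + 1) (k + 1) / ((k : ℝ) + 1)
      ≤ 1 / √((n : ℝ) + 1) * (1 / √((k : ℝ) + 1) + 1 / √(((n - 1 - k : ℕ) : ℝ) + 1)) := by
    intro k hk
    have h2 : ((n - 1 - k : ℕ) : ℝ) + 1 = n - k := by
      have h3 : n - 1 - k + 1 + k = n := by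
        have := Finset.mem_range.1 hk
        omega
      rw [eq_sub_iff_add_eq]
      exact_mod_cast h3
    have h4 := sqrt_div_div_le (a := (k : ℝ) + 1) (b := ((n - 1 - k : ℕ) : ℝ) + 1)
      (by positivity) (by positivity)
    rw [sqrtRatio]
    convert h4 using 3
    · push_cast
      rw [h2]
      ring_nf
    · rw [h2]
      ring_nf
  refine (Finset.sum_le_sum h1).trans ?_
  rw [← Finset.mul_sum, Finset.sum_add_distrib,
    Finset.sum_range_reflect (fun k => 1 / √((k : ℝ) + 1)), one_div_mul_eq_div,
    div_le_iff₀ (by positivity)]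
  have h5 : √(n : ℝ) ≤ √((n : ℝ) + 1) := Real.sqrt_le_sqrt (by linarith)
  linarith [sum_one_div_sqrt_le n]

theorem uaMean_sqrt_competitiveRatio_le (n : ℕ) :
    uaMean (n + 1) (fun t => ENNReal.ofReal (√t.competitiveRatio))
      ≤ ENNReal.ofReal (Real.exp 4) := by
  refine (uaMean_mono (g := totalWeight fun k => ENNReal.ofReal (sqrtRatio (n + 1) k))
    fun t ht => ?_).trans ?_
  · simpa only [ht] using t.sqrt_competitiveRatio_le
  · rw [uaMean_totalWeight]
    calc _ ≤ ∏ k ∈ Finset.range n,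
          ENNReal.ofReal (Real.exp (sqrtRatio (n + 1) (k + 1) / ((k : ℝ) + 1))) := by
          refine Finset.prod_le_prod' fun k _ => ?_
          have h1 : (0 : ℝ) < (k : ℝ) + 1 := by positivity
          have h2 : ((k : ℝ≥0∞) + 1) = ENNReal.ofReal ((k : ℝ) + 1) := by
            rw [ENNReal.ofReal_add (by positivity) zero_le_one]
            simp
          have h3 : 0 ≤ sqrtRatio (n + 1) (k + 1) / ((k : ℝ) + 1) :=
            div_nonneg (Real.sqrt_nonneg _) h1.le
          rw [h2, ← ENNReal.ofReal_div_of_pos h1, ← ENNReal.ofReal_one,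
            ← ENNReal.ofReal_add zero_le_one h3, add_comm]
          exact ENNReal.ofReal_le_ofReal (Real.add_one_le_exp _)
      _ = ENNReal.ofReal
          (Real.exp (∑ k ∈ Finset.range n, sqrtRatio (n + 1) (k + 1) / ((k : ℝ) + 1))) := by
          rw [Real.exp_sum, ENNReal.ofReal_prod_of_nonneg fun _ _ => (Real.exp_pos _).le]
      _ ≤ _ := ENNReal.ofReal_le_ofReal (Real.exp_le_exp.2 (sum_sqrtRatio_div_le n))

/-- Markov's inequality for `√Φ`. -/
theorem uaLaw_le_competitiveRatio (n : ℕ) {x : ℝ} (hx : 0 < x) :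
    (uaLaw (n + 1)).toMeasure {t | x ≤ t.competitiveRatio}
      ≤ ENNReal.ofReal (Real.exp 4 * x ^ (-(1 / 2) : ℝ)) := by
  classical
  have h0 : x ^ (-(1 / 2) : ℝ) * √x = 1 := by
    rw [Real.sqrt_eq_rpow, ← Real.rpow_add hx]
    simp
  have h1 : 0 ≤ x ^ (-(1 / 2) : ℝ) := (Real.rpow_pos_of_pos hx _).le
  rw [mul_comm, ENNReal.ofReal_mul h1]
  refine le_trans ?_ (mul_le_mul_right (uaMean_sqrt_competitiveRatio_le n) _)
  rw [← uaMean_const_mul, PMF.toMeasure_apply _ MeasurableSpace.measurableSet_top]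
  refine ENNReal.tsum_le_tsum fun t => ?_
  refine Set.indicator_apply_le' (fun ht => ?_) fun _ => zero_le
  refine le_mul_of_one_le_right' ?_
  dsimp only
  rw [← ENNReal.ofReal_mul h1, ENNReal.one_le_ofReal]
  exact h0.ge.trans (mul_le_mul_of_nonneg_left (Real.sqrt_le_sqrt ht) h1)

end PlaneTree

theorem mainTheorem6 :
    ∃ C c : ℝ, 0 < C ∧ 0 < c ∧
      ∀ (Ω : ℕ → Type*) [∀ n, MeasurableSpace (Ω n)] (P : ∀ n, Measure (Ω n))
        (T : ∀ n, Ω n → PlaneTree),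
        (∀ n, 1 ≤ n → HasLaw (T n) (PlaneTree.uaLaw n).toMeasure (P n)) →
        ∀ x : ℝ, 1 ≤ x →
          limsup (fun n => P n {ω | x ≤ (T n ω).competitiveRatio}) atTop
            ≤ ENNReal.ofReal (C * x ^ (-c)) := by
  refine ⟨Real.exp 4, 1 / 2, Real.exp_pos 4, by norm_num, fun Ω _ P T hT x hx => ?_⟩
  -- The bound holds for every `n ≥ 1`, not only in the limit.
  refine limsup_le_of_le (by isBoundedDefault) ?_
  filter_upwards [eventually_ge_atTop 1] with n hn
  obtain ⟨m, rfl⟩ := Nat.exists_eq_add_of_le' hn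
  refine le_trans (le_of_eq ?_) (PlaneTree.uaLaw_le_competitiveRatio m (zero_lt_one.trans_le hx))
  rw [← (hT _ hn).map_eq, Measure.map_apply_of_aemeasurable (hT _ hn).aemeasurable
    MeasurableSpace.measurableSet_top]
  rfl
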